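/- For a finite simple graph $G$, let $\tau(G)$ be the largest number of vertices in an induced forest of $G$; a set of $\tau(G)$ vertices inducing a forest is called a maximum induced forest. An induced forest with vertex set $S$ is called canonical if there is a vertex $v\in S$ such that $S\setminus\{v\}$ is an independent set. For a prime power $q$, the $q$-Kneser graph $K_q(n,k)$ has as vertices the $k$-dimensional subspaces of $\mathbb{F}_q^n$, two of them being adjacent if and only if they intersect trivially. Let $$\binom{m}{j}_q=\prod_{i=0}^{j-1}\frac{q^{m-i}-1}{q^{i+1}-1}$$ denote the Gaussian binomial coefficient. Theorem. Let $k\ge 2$ and $n>3k-2$ be integers. There is a number $q_0=q_0(n,k)$ such that for every prime power $q\ge q_0$, $$\tau(K_q(n,k))=\binom{n-1}{k-1}_q+1,$$ and every maximum induced forest of $K_q(n,k)$ is canonical. -/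

import Mathlib

namespace SimpleGraph

variable {V : Type*} (G : SimpleGraph V)

/-- The vertex set `S` induces a forest in `G`. -/
def IsInducedForest (S : Finset V) : Prop :=
  (G.induce (S : Set V)).IsAcyclic

/-- The order `τ(G)` of a largest induced forest of a finite graph `G`. -/
noncomputable def maxForestOrder : ℕ :=
  sSup {m : ℕ | ∃ S : Finset V, G.IsInducedForest S ∧ S.card = m}

/-- `S` induces a forest of maximum possible order. -/
def IsMaximumInducedForest (S : Finset V) : Prop :=
  G.IsInducedForest S ∧ ∀ T : Finset V, G.IsInducedForest T → T.card ≤ S.card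

/-- `S` is a canonical induced forest: it induces a forest, and removing some vertex `v ∈ S`
leaves an independent set. -/
def IsCanonicalForest (S : Finset V) : Prop :=
  G.IsInducedForest S ∧ ∃ v ∈ S, G.IsIndepSet ((S : Set V) \ {v})

end SimpleGraph

/-- The `q`-Kneser graph over the field `F` (with `q` elements): the vertices are the
`k`-dimensional subspaces of `F ^ n`, and two of them are adjacent when they intersect trivially.
For `k ≥ 1` the condition `U ≠ W` is automatic; it only removes the loop when `k = 0`. -/
def qKneserGraph (F : Type*) [Field F] (n k : ℕ) :
    SimpleGraph {U : Submodule F (Fin n → F) // Module.finrank F U = k} where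
  Adj U W := U ≠ W ∧ U.1 ⊓ W.1 = ⊥
  symm := ⟨fun U W h => ⟨h.1.symm, by rw [inf_comm]; exact h.2⟩⟩
  loopless := ⟨fun _ h => h.1 rfl⟩

/-- The Gaussian binomial coefficient
`∏_{i < k} (q ^ (n - i) - 1) / (q ^ (i + 1) - 1)`, for `q ≥ 2`. It is `0` if `k > n`
(the factor with `i = n` vanishes). -/
def gaussBinom (q n k : ℕ) : ℚ :=
  ∏ i ∈ Finset.range k, ((q : ℚ) ^ (n - i) - 1) / ((q : ℚ) ^ (i + 1) - 1)

open Module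

/-! ### Counting subspaces -/

section Counting

variable {F V : Type*} [Field F] [AddCommGroup V] [Module F V]

/-! Let `N` and `X` count the `k`-spaces through a point and through a line, and let `c` bound the
points of a `k`-space. All `k`-spaces through a point, plus one off it, give a forest of order `N +
1`. Conversely, a forest `S` with more than `N` vertices is bipartite, so it has an independent `A`
with `|S| ≤ 2|A|`. Without a common point, `|A| ≤ c²X` (`card_le_of_intersecting`). With a common
point `P` and two members of `S` off `P`, acyclicity forbids a 4-cycle and leaves at most `2cX + 1`
members through `P` (`card_through_le_of_two_off`). For large `q` both bounds are at most `N / 2`,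
because `c ≤ 2q^(k-1)` while `N ≥ q^(n-k) X`. Hence exactly one member misses `P`. -/

/-- The linearly independent `k`-tuples that span a given `k`-dimensional subspace are the
linearly independent `k`-tuples inside it. -/
noncomputable def linearIndependentFiberEquiv {k : ℕ} (U : Submodule F V)
    (hU : finrank F U = k) [Module.Finite F V] :
    {s : {s : Fin k → V // LinearIndependent F s} // Submodule.span F (Set.range s.1) = U} ≃
      {s : Fin k → U // LinearIndependent F s} where
  toFun s := ⟨fun i => ⟨s.1.1 i, s.2.le (Submodule.subset_span (Set.mem_range_self i))⟩,
    LinearIndependent.of_comp U.subtype s.1.2⟩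
  invFun t := ⟨⟨U.subtype ∘ t.1, t.2.map' U.subtype U.ker_subtype⟩, by
    refine Submodule.eq_of_le_of_finrank_eq (Submodule.span_le.2 ?_) ?_
    · rintro _ ⟨i, rfl⟩
      exact (t.1 i).2
    · rw [finrank_span_eq_card (t.2.map' U.subtype U.ker_subtype), Fintype.card_fin, hU]⟩
  left_inv _ := rfl
  right_inv _ := rfl

/-- Count linearly independent `k`-tuples by their span. -/
theorem card_subspaces_mul_prod [Finite F] [Module.Finite F V] {k : ℕ} (hk : k ≤ finrank F V) :
    Nat.card {U : Submodule F V // finrank F U = k} *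
        ∏ i ∈ Finset.range k, (Nat.card F ^ k - Nat.card F ^ i) =
      ∏ i ∈ Finset.range k, (Nat.card F ^ finrank F V - Nat.card F ^ i) := by
  have := Fintype.ofFinite F
  have : Finite V := Module.finite_of_finite F
  let f : {s : Fin k → V // LinearIndependent F s} → {U : Submodule F V // finrank F U = k} :=
    fun s => ⟨Submodule.span F (Set.range s.1), by
      rw [finrank_span_eq_card s.2, Fintype.card_fin]⟩
  have e : {s : Fin k → V // LinearIndependent F s} ≃
      Σ U : {U : Submodule F V // finrank F U = k}, {s : Fin k → U.1 // LinearIndependent F s} :=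
    (Equiv.sigmaFiberEquiv f).symm.trans <| Equiv.sigmaCongrRight fun U =>
      (Equiv.subtypeEquivRight fun s => Subtype.ext_iff).trans
        (linearIndependentFiberEquiv U.1 U.2)
  have hfib (U : {U : Submodule F V // finrank F U = k}) :
      Nat.card {s : Fin k → U.1 // LinearIndependent F s} =
        ∏ i ∈ Finset.range k, (Nat.card F ^ k - Nat.card F ^ i) := by
    rw [card_linearIndependent U.2.ge, U.2, Nat.card_eq_fintype_card]
    exact Fin.prod_univ_eq_prod_range (fun i => Fintype.card F ^ k - Fintype.card F ^ i) k
  have := Fintype.ofFinite {U : Submodule F V // finrank F U = k}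
  have h := Nat.card_congr e
  rw [card_linearIndependent hk, Nat.card_sigma, Finset.sum_congr rfl fun U _ => hfib U,
    Finset.sum_const, smul_eq_mul, Finset.card_univ, ← Nat.card_eq_fintype_card,
    ← Nat.card_eq_fintype_card] at h
  rw [← h]
  exact Fin.prod_univ_eq_prod_range (fun i => Nat.card F ^ finrank F V - Nat.card F ^ i) k

theorem prod_pow_sub_pow_eq {q n k : ℕ} (hq : 2 ≤ q) (hk : k ≤ n) :
    ((∏ i ∈ Finset.range k, (q ^ n - q ^ i) : ℕ) : ℚ) =
      (∏ i ∈ Finset.range k, (q : ℚ) ^ i) * ∏ i ∈ Finset.range k, ((q : ℚ) ^ (n - i) - 1) := by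
  rw [← Finset.prod_mul_distrib, Nat.cast_prod]
  refine Finset.prod_congr rfl fun i hi => ?_
  have hi' : i ≤ n := (Finset.mem_range.1 hi).le.trans hk
  rw [Nat.cast_sub (Nat.pow_le_pow_right (by lia) hi'), mul_sub, ← pow_add,
    Nat.add_sub_cancel' hi']
  simp

theorem card_subspaces_eq_gaussBinom [Finite F] [Module.Finite F V] {k : ℕ}
    (hk : k ≤ finrank F V) :
    (Nat.card {U : Submodule F V // finrank F U = k} : ℚ) =
      gaussBinom (Nat.card F) (finrank F V) k := by
  have hq : 2 ≤ Nat.card F := Finite.one_lt_card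
  have hq' : (1 : ℚ) < Nat.card F := by exact_mod_cast hq
  have h := congrArg (Nat.cast : ℕ → ℚ) (card_subspaces_mul_prod (F := F) (V := V) hk)
  rw [Nat.cast_mul, prod_pow_sub_pow_eq hq le_rfl, prod_pow_sub_pow_eq hq hk] at h
  have h0 : (∏ i ∈ Finset.range k, (Nat.card F : ℚ) ^ i) ≠ 0 :=
    Finset.prod_ne_zero_iff.2 fun i _ => by positivity
  -- The count of bases of a `k`-space gives the denominator with its factors reversed.
  have hrefl : ∏ i ∈ Finset.range k, ((Nat.card F : ℚ) ^ (k - i) - 1) =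
      ∏ i ∈ Finset.range k, ((Nat.card F : ℚ) ^ (i + 1) - 1) := by
    rw [← Finset.prod_range_reflect]
    refine Finset.prod_congr rfl fun i hi => ?_
    rw [Finset.mem_range] at hi
    congr 2
    lia
  have h1 : ∏ i ∈ Finset.range k, ((Nat.card F : ℚ) ^ (i + 1) - 1) ≠ 0 :=
    Finset.prod_ne_zero_iff.2 fun i _ => (sub_pos.2 (one_lt_pow₀ hq' (by lia))).ne'
  rw [gaussBinom, Finset.prod_div_distrib, eq_div_iff h1, ← hrefl]
  refine mul_left_cancel₀ h0 ?_
  rw [← h]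
  ring

/-- The `k`-dimensional subspaces containing `W` are counted in the quotient by `W`. -/
theorem card_subspaces_ge [Finite F] [Module.Finite F V] (W : Submodule F V) {k : ℕ}
    (hWk : finrank F W ≤ k) (hk : k ≤ finrank F V) :
    (Nat.card {U : {U : Submodule F V // finrank F U = k} // W ≤ U.1} : ℚ) =
      gaussBinom (Nat.card F) (finrank F V - finrank F W) (k - finrank F W) := by
  have hV : finrank F (V ⧸ W) = finrank F V - finrank F W := Submodule.finrank_quotient W
  rw [← hV, ← card_subspaces_eq_gaussBinom (by lia)]
  congr 1
  refine Nat.card_congr ?_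
  have key (U : Submodule F (V ⧸ W)) :
      finrank F (U.comap W.mkQ) = finrank F U + finrank F W := by
    have h := Submodule.finrank_quotient_add_finrank (U.comap W.mkQ)
    have h' := Submodule.finrank_quotient_add_finrank U
    have h'' := Submodule.finrank_quotient_add_finrank W
    have e : finrank F (V ⧸ U.comap W.mkQ) = finrank F ((V ⧸ W) ⧸ U) := by
      have e := Submodule.quotientQuotientEquivQuotient W (U.comap W.mkQ) (Submodule.le_comap_mkQ W U)
      rw [Submodule.map_comap_eq_self (by simp)] at e
      exact e.finrank_eq.symm
    lia
  refine Equiv.trans (β := {U : Set.Ici W // finrank F U.1 = k}) ?_ ?_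
  · exact
    { toFun := fun U => ⟨⟨U.1.1, U.2⟩, U.1.2⟩
      invFun := fun U => ⟨⟨U.1.1, U.2⟩, U.1.2⟩
      left_inv := fun _ => rfl
      right_inv := fun _ => rfl }
  · refine ((Submodule.comapMkQRelIso W).toEquiv.subtypeEquiv fun U => ?_).symm
    have := key U
    change _ ↔ finrank F (U.comap W.mkQ) = k
    lia

end Counting

/-! ### Bounds for Gaussian binomials -/

section Estimates

variable {q : ℕ}

theorem gaussBinom_one_le (hq : 2 ≤ q) {k : ℕ} (hk : 1 ≤ k) :
    gaussBinom q k 1 ≤ 2 * (q : ℚ) ^ (k - 1) := by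
  have hq' : (2 : ℚ) ≤ q := by exact_mod_cast hq
  obtain ⟨k, rfl⟩ := Nat.exists_eq_add_of_le' hk
  simp only [gaussBinom, Finset.prod_range_one, Nat.sub_zero, zero_add, pow_one,
    Nat.add_sub_cancel]
  rw [div_le_iff₀ (by linarith), pow_succ]
  nlinarith [pow_pos (by linarith : (0 : ℚ) < q) k]

/-- The quotient of the two coefficients is `(q^(n+1) - 1) / (q^(k+1) - 1)`. This compares stars of
points with stars of lines. -/
theorem pow_mul_gaussBinom_le (hq : 2 ≤ q) {n k : ℕ} (hk : k ≤ n)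
    (h0 : 0 ≤ gaussBinom q n k) :
    (q : ℚ) ^ (n - k) * gaussBinom q n k ≤ gaussBinom q (n + 1) (k + 1) := by
  have hq' : (1 : ℚ) < q := by exact_mod_cast hq
  have hpos : (0 : ℚ) < (q : ℚ) ^ (k + 1) - 1 := sub_pos.2 (one_lt_pow₀ hq' (by lia))
  have h : gaussBinom q (n + 1) (k + 1) =
      ((q : ℚ) ^ (n + 1) - 1) / ((q : ℚ) ^ (k + 1) - 1) * gaussBinom q n k := by
    simp only [gaussBinom, Finset.prod_div_distrib]
    rw [Finset.prod_range_succ' (fun i => (q : ℚ) ^ (n + 1 - i) - 1),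
      Finset.prod_range_succ (fun i => (q : ℚ) ^ (i + 1) - 1)]
    simp only [Nat.add_sub_add_right, Nat.sub_zero]
    rw [mul_comm, mul_comm (∏ i ∈ Finset.range k, _) ((q : ℚ) ^ (k + 1) - 1), mul_div_mul_comm]
  rw [h]
  refine mul_le_mul_of_nonneg_right ?_ h0
  rw [le_div_iff₀ hpos, mul_sub, ← pow_add, show n - k + (k + 1) = n + 1 by lia]
  have : (1 : ℚ) ≤ (q : ℚ) ^ (n - k) := one_le_pow₀ hq'.le
  linarith

end Estimates

theorem gaussBinom_pos {q n k : ℕ} (hq : 2 ≤ q) (hk : k ≤ n) : 0 < gaussBinom q n k := by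
  have hq' : (1 : ℚ) < q := by exact_mod_cast hq
  refine Finset.prod_pos fun i hi => ?_
  rw [Finset.mem_range] at hi
  exact div_pos (sub_pos.2 (one_lt_pow₀ hq' (by lia))) (sub_pos.2 (one_lt_pow₀ hq' (by lia)))

/-! ### Induced forests in general graphs -/

namespace SimpleGraph

variable {V : Type*} {G : SimpleGraph V}

/-- Every edge meets `v`, so the induced graph lies in a star centred at `v`. -/
theorem isInducedForest_of_isIndepSet_diff {S : Finset V} {v : V} (hv : v ∈ S)
    (h : G.IsIndepSet ((S : Set V) \ {v})) : G.IsInducedForest S := by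
  refine (isAcyclic_starGraph (⟨v, hv⟩ : (S : Set V))).anti fun x y hxy => ?_
  rw [starGraph_adj]
  refine ⟨hxy.ne, ?_⟩
  by_contra! hne
  exact h ⟨x.2, fun hx => hne.1 (Subtype.ext hx)⟩ ⟨y.2, fun hy => hne.2 (Subtype.ext hy)⟩
    (fun e => hxy.ne (Subtype.ext e)) hxy

/-- An induced forest is bipartite, so half of its vertices form an independent set. -/
theorem IsInducedForest.exists_isIndepSet {S : Finset V} (h : G.IsInducedForest S) :
    ∃ A ⊆ S, G.IsIndepSet (A : Set V) ∧ S.card ≤ 2 * A.card := by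
  classical
  obtain ⟨C⟩ := h.colorable_two
  let A (i : Fin 2) : Finset V := (S.attach.filter fun x => C ⟨x.1, x.2⟩ = i).map
    (Function.Embedding.subtype _)
  have hsub (i) : A i ⊆ S := by
    intro x hx
    obtain ⟨y, -, rfl⟩ := Finset.mem_map.1 hx
    exact y.2
  have hind (i) : G.IsIndepSet (A i : Set V) := by
    intro x hx y hy _ hxy
    obtain ⟨x, hx', rfl⟩ := Finset.mem_map.1 (Finset.mem_coe.1 hx)
    obtain ⟨y, hy', rfl⟩ := Finset.mem_map.1 (Finset.mem_coe.1 hy)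
    have hadj : (G.induce (S : Set V)).Adj ⟨x.1, x.2⟩ ⟨y.1, y.2⟩ := hxy
    exact C.valid hadj ((Finset.mem_filter.1 hx').2.trans (Finset.mem_filter.1 hy').2.symm)
  have hcard : S.card ≤ (A 0).card + (A 1).card := by
    rw [Finset.card_map, Finset.card_map, ← Finset.card_attach]
    refine (Finset.card_le_card fun x hx => ?_).trans (Finset.card_union_le _ _)
    have : ∀ i : Fin 2, i = 0 ∨ i = 1 := by decide
    simpa using this (C ⟨x.1, x.2⟩)
  rcases le_total (A 0).card (A 1).card with hle | hle
  · exact ⟨A 1, hsub 1, hind 1, by lia⟩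
  · exact ⟨A 0, hsub 0, hind 0, by lia⟩

/-- Two vertices of an induced forest have at most one common neighbour in it. -/
theorem IsInducedForest.eq_of_common_adj {S : Finset V} (h : G.IsInducedForest S)
    {a b c d : V} (ha : a ∈ S) (hb : b ∈ S) (hc : c ∈ S) (hd : d ∈ S) (hab : a ≠ b)
    (hac : G.Adj a c) (hcb : G.Adj c b) (had : G.Adj a d) (hdb : G.Adj d b) : c = d := by
  -- Two distinct common neighbours would give two different paths from `a` to `b`.
  have path {x : V} (hx : x ∈ S) (hax : G.Adj a x) (hxb : G.Adj x b) :
      ∃ p : (G.induce (S : Set V)).Path ⟨a, ha⟩ ⟨b, hb⟩,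
        p.1.support = [⟨a, ha⟩, ⟨x, hx⟩, ⟨b, hb⟩] := by
    have h₁ : (G.induce (S : Set V)).Adj ⟨a, ha⟩ ⟨x, hx⟩ := hax
    have h₂ : (G.induce (S : Set V)).Adj ⟨x, hx⟩ ⟨b, hb⟩ := hxb
    have h₃ : (Walk.cons h₁ (.cons h₂ .nil)).IsPath := by
      simp [Walk.isPath_def, hab, hax.ne, hxb.ne]
    exact ⟨⟨_, h₃⟩, rfl⟩
  obtain ⟨p, hp⟩ := path hc hac hcb
  obtain ⟨r, hr⟩ := path hd had hdb
  rw [(h.subsingleton_path _ _).elim p r, hr] at hp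
  simpa using hp.symm

end SimpleGraph

/-! ### Intersecting families of subspaces -/

section Kneser

variable {F V : Type*} [Field F] [AddCommGroup V] [Module F V] [Finite F] [Module.Finite F V]

instance Submodule.finite_subtype_finrank (k : ℕ) :
    Finite {U : Submodule F V // finrank F U = k} :=
  have : Finite V := Module.finite_of_finite F
  inferInstance

variable (k : ℕ)

/-- The `k`-dimensional subspaces that contain `W`. -/
noncomputable def subspacesThrough (W : Submodule F V) :
    Finset {U : Submodule F V // finrank F U = k} :=
  (Set.toFinite {U : {U : Submodule F V // finrank F U = k} | W ≤ U.1}).toFinset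

/-- The one-dimensional subspaces of `U`. -/
noncomputable def pointsOf (U : Submodule F V) : Finset (Submodule F V) :=
  have : Finite V := Module.finite_of_finite F
  (Set.toFinite {P : Submodule F V | finrank F P = 1 ∧ P ≤ U}).toFinset

variable {k}

theorem mem_subspacesThrough {W : Submodule F V} {U : {U : Submodule F V // finrank F U = k}} :
    U ∈ subspacesThrough k W ↔ W ≤ U.1 := by
  simp [subspacesThrough]

theorem mem_pointsOf {P U : Submodule F V} : P ∈ pointsOf U ↔ finrank F P = 1 ∧ P ≤ U := by
  simp [pointsOf]

theorem card_subspacesThrough (W : Submodule F V) (hWk : finrank F W ≤ k)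
    (hk : k ≤ finrank F V) :
    ((subspacesThrough k W).card : ℚ) =
      gaussBinom (Nat.card F) (finrank F V - finrank F W) (k - finrank F W) := by
  rw [← card_subspaces_ge W hWk hk, subspacesThrough, ← Set.ncard_eq_toFinset_card]
  rfl

theorem card_pointsOf_le {U : Submodule F V} (hU : finrank F U = k) (hk : 1 ≤ k) :
    (pointsOf U).card ≤ 2 * Nat.card F ^ (k - 1) := by
  have h := (card_subspaces_eq_gaussBinom (F := F) (V := U) (hk.trans hU.ge)).le.trans
    ((congrArg (gaussBinom (Nat.card F) · 1) hU).le.trans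
      (gaussBinom_one_le (Finite.one_lt_card (α := F)) hk))
  have : Finite V := Module.finite_of_finite F
  refine le_trans ?_ (show Nat.card {P : Submodule F U // finrank F P = 1} ≤ _ by exact_mod_cast h)
  rw [pointsOf, ← Set.ncard_eq_toFinset_card]
  let f : {P : Submodule F V | finrank F P = 1 ∧ P ≤ U} →
      {P : Submodule F U // finrank F P = 1} := fun P => ⟨P.1.comap U.subtype, by
    rw [(Submodule.comapSubtypeEquivOfLe P.2.2).finrank_eq, P.2.1]⟩
  refine Nat.card_le_card_of_injective f fun P Q hPQ => Subtype.ext ?_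
  have := congrArg (Submodule.map U.subtype) (Subtype.ext_iff.1 hPQ)
  simpa [f, Submodule.map_comap_subtype, P.2.2, Q.2.2] using this

theorem exists_mem_pointsOf_le {U W : Submodule F V} (h : U ⊓ W ≠ ⊥) :
    ∃ P ∈ pointsOf U, P ≤ W := by
  obtain ⟨v, hv, hv0⟩ := Submodule.exists_mem_ne_zero_of_ne_bot h
  have hle := (Submodule.span_singleton_le_iff_mem v (U ⊓ W)).2 hv
  exact ⟨Submodule.span F {v}, mem_pointsOf.2 ⟨finrank_span_singleton hv0, hle.trans inf_le_left⟩,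
    hle.trans inf_le_right⟩

theorem finrank_sup_of_point {P Q U : Submodule F V} (hP : finrank F P = 1)
    (hQ : Q ∈ pointsOf U) (hPU : ¬ P ≤ U) : finrank F (P ⊔ Q : Submodule F V) = 2 := by
  obtain ⟨hQ, hQU⟩ := mem_pointsOf.1 hQ
  have hbot : P ⊓ Q = ⊥ := by
    by_contra hne
    have h0 : 0 < finrank F (P ⊓ Q : Submodule F V) :=
      Nat.pos_of_ne_zero fun h => hne (Submodule.finrank_eq_zero.1 h)
    have : P ⊓ Q = P := Submodule.eq_of_le_of_finrank_le inf_le_left (by lia)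
    exact hPU ((inf_eq_left.1 this).trans hQU)
  have := Submodule.finrank_sup_add_finrank_inf_eq P Q
  rw [hbot, finrank_bot] at this
  lia

/-- Few `k`-spaces through a point `P` meet a given `k`-space off `P`. -/
theorem card_le_of_forall_inf_ne_bot {c X : ℕ}
    (hc : ∀ U : Submodule F V, finrank F U = k → (pointsOf U).card ≤ c)
    (hX : ∀ W : Submodule F V, finrank F W = 2 → (subspacesThrough k W).card ≤ X)
    {P : Submodule F V} (hP : finrank F P = 1)
    {U : {U : Submodule F V // finrank F U = k}} (hPU : ¬ P ≤ U.1)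
    {B : Finset {U : Submodule F V // finrank F U = k}}
    (hB : ∀ W ∈ B, P ≤ W.1 ∧ U.1 ⊓ W.1 ≠ ⊥) : B.card ≤ c * X := by
  classical
  -- Each `W` in `B` contains a line joining `P` to one of the at most `c` points of `U`.
  have hsub : B ⊆ (pointsOf U.1).biUnion fun Q => subspacesThrough k (P ⊔ Q) := by
    intro W hW
    obtain ⟨Q, hQ, hQW⟩ := exists_mem_pointsOf_le (hB W hW).2
    exact Finset.mem_biUnion.2 ⟨Q, hQ, mem_subspacesThrough.2 (sup_le (hB W hW).1 hQW)⟩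
  exact (Finset.card_le_card hsub).trans <| (Finset.card_biUnion_le_card_mul _ _ X
    fun Q hQ => hX _ (finrank_sup_of_point hP hQ hPU)).trans (Nat.mul_le_mul_right _ (hc _ U.2))

/-- A pairwise intersecting family of `k`-spaces without a common point is small. -/
theorem card_le_of_intersecting {c X : ℕ}
    (hc : ∀ U : Submodule F V, finrank F U = k → (pointsOf U).card ≤ c)
    (hX : ∀ W : Submodule F V, finrank F W = 2 → (subspacesThrough k W).card ≤ X)
    {A : Finset {U : Submodule F V // finrank F U = k}}
    (hA : ∀ U ∈ A, ∀ W ∈ A, U.1 ⊓ W.1 ≠ ⊥)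
    (hpt : ∀ P : Submodule F V, finrank F P = 1 → ∃ U ∈ A, ¬ P ≤ U.1) :
    A.card ≤ c * (c * X) := by
  classical
  obtain rfl | ⟨U, hU⟩ := A.eq_empty_or_nonempty
  · simp
  have hsub : A ⊆ (pointsOf U.1).biUnion fun P => A.filter fun W => P ≤ W.1 := by
    intro W hW
    obtain ⟨P, hP, hPW⟩ := exists_mem_pointsOf_le (hA U hU W hW)
    exact Finset.mem_biUnion.2 ⟨P, hP, Finset.mem_filter.2 ⟨hW, hPW⟩⟩
  refine (Finset.card_le_card hsub).trans <| (Finset.card_biUnion_le_card_mul _ _ (c * X)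
    fun P hP => ?_).trans (Nat.mul_le_mul_right _ (hc _ U.2))
  -- Some member `T` misses `P`, yet all members through `P` meet `T`, so the previous bound
  -- applies.
  obtain ⟨T, hT, hPT⟩ := hpt P (mem_pointsOf.1 hP).1
  refine card_le_of_forall_inf_ne_bot hc hX (mem_pointsOf.1 hP).1 hPT fun W hW => ?_
  exact ⟨(Finset.mem_filter.1 hW).2, hA T hT W (Finset.mem_filter.1 hW).1⟩

end Kneser

/-! ### Large forests in the `q`-Kneser graph -/

section Main

variable {F : Type*} [Field F] {n k : ℕ}

theorem qKneserGraph_inf_ne_bot (hk : 1 ≤ k)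
    {A : Finset {U : Submodule F (Fin n → F) // finrank F U = k}}
    (hA : (qKneserGraph F n k).IsIndepSet (A : Set _)) :
    ∀ U ∈ A, ∀ W ∈ A, U.1 ⊓ W.1 ≠ ⊥ := by
  intro U hU W hW h
  by_cases hUW : U = W
  · subst hUW
    rw [inf_idem] at h
    have := U.2
    rw [h, finrank_bot] at this
    lia
  · exact hA hU hW hUW ⟨hUW, h⟩

theorem qKneserGraph_isIndepSet_of_point (P : Submodule F (Fin n → F)) (hP : finrank F P = 1)
    {B : Set {U : Submodule F (Fin n → F) // finrank F U = k}} (hB : ∀ U ∈ B, P ≤ U.1) :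
    (qKneserGraph F n k).IsIndepSet B := by
  intro U hU W hW _ hadj
  have h := le_inf (hB U hU) (hB W hW)
  rw [hadj.2, le_bot_iff] at h
  rw [h, finrank_bot] at hP
  lia

/-- In an induced forest with two members off the point `P`, few members pass through `P`. -/
theorem card_through_le_of_two_off [Finite F] {c X : ℕ}
    (hc : ∀ U : Submodule F (Fin n → F), finrank F U = k → (pointsOf U).card ≤ c)
    (hX : ∀ W : Submodule F (Fin n → F), finrank F W = 2 → (subspacesThrough k W).card ≤ X)
    {S B : Finset {U : Submodule F (Fin n → F) // finrank F U = k}}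
    (hS : (qKneserGraph F n k).IsInducedForest S) {P : Submodule F (Fin n → F)}
    (hP : finrank F P = 1) (hBS : B ⊆ S) (hB : ∀ U ∈ B, P ≤ U.1)
    {T₁ T₂ : {U : Submodule F (Fin n → F) // finrank F U = k}} (hT₁ : T₁ ∈ S) (hT₂ : T₂ ∈ S)
    (hne : T₁ ≠ T₂) (hP₁ : ¬ P ≤ T₁.1) (hP₂ : ¬ P ≤ T₂.1) :
    B.card ≤ c * X + c * X + 1 := by
  classical
  let M (T : {U : Submodule F (Fin n → F) // finrank F U = k}) :=
    B.filter fun U => T.1 ⊓ U.1 ≠ ⊥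
  have hM {T : {U : Submodule F (Fin n → F) // finrank F U = k}} (hPT : ¬ P ≤ T.1) :
      (M T).card ≤ c * X :=
    card_le_of_forall_inf_ne_bot hc hX hP hPT fun U hU =>
      ⟨hB U (Finset.mem_filter.1 hU).1, (Finset.mem_filter.1 hU).2⟩
  -- `D` consists of common neighbours of `T₁` and `T₂`, and a forest allows only one.
  let D := B.filter fun U => T₁.1 ⊓ U.1 = ⊥ ∧ T₂.1 ⊓ U.1 = ⊥
  have hadj {T U : {U : Submodule F (Fin n → F) // finrank F U = k}} (hPT : ¬ P ≤ T.1)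
      (hU : U ∈ B) (h : T.1 ⊓ U.1 = ⊥) : (qKneserGraph F n k).Adj T U :=
    ⟨fun e => hPT (e ▸ hB U hU), h⟩
  have hD : D.card ≤ 1 := Finset.card_le_one.2 fun U hU W hW => by
    obtain ⟨hUB, hU₁, hU₂⟩ := Finset.mem_filter.1 hU
    obtain ⟨hWB, hW₁, hW₂⟩ := Finset.mem_filter.1 hW
    exact hS.eq_of_common_adj hT₁ hT₂ (hBS hUB) (hBS hWB) hne (hadj hP₁ hUB hU₁)
      (hadj hP₂ hUB hU₂).symm (hadj hP₁ hWB hW₁) (hadj hP₂ hWB hW₂).symm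
  have hsub : B ⊆ (M T₁ ∪ M T₂) ∪ D := by
    intro U hU
    simp only [M, D, Finset.mem_union, Finset.mem_filter]
    tauto
  calc B.card ≤ _ := Finset.card_le_card hsub
    _ ≤ _ := Finset.card_union_le _ _
    _ ≤ _ := add_le_add ((Finset.card_union_le _ _).trans (add_le_add (hM hP₁) (hM hP₂))) hD

/-- A large induced forest consists of a full star together with one further vertex. -/
theorem card_eq_and_exists_of_large_forest [Finite F] {c X N : ℕ} (hk : 1 ≤ k)
    (hc : ∀ U : Submodule F (Fin n → F), finrank F U = k → (pointsOf U).card ≤ c)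
    (hX : ∀ W : Submodule F (Fin n → F), finrank F W = 2 → (subspacesThrough k W).card ≤ X)
    (hN : ∀ W : Submodule F (Fin n → F), finrank F W = 1 → (subspacesThrough k W).card ≤ N)
    (h₁ : 2 * (c * (c * X)) ≤ N) (h₂ : 2 * (c * X + c * X + 1) ≤ N)
    {S : Finset {U : Submodule F (Fin n → F) // finrank F U = k}}
    (hS : (qKneserGraph F n k).IsInducedForest S) (hSN : N + 1 ≤ S.card) :
    S.card = N + 1 ∧ ∃ v ∈ S, (qKneserGraph F n k).IsIndepSet ((S : Set _) \ {v}) := by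
  classical
  obtain ⟨A, hAS, hA, hcard⟩ := hS.exists_isIndepSet
  obtain ⟨P, hP, hPA⟩ : ∃ P : Submodule F (Fin n → F), finrank F P = 1 ∧ ∀ U ∈ A, P ≤ U.1 := by
    by_contra! hno
    have := card_le_of_intersecting hc hX (qKneserGraph_inf_ne_bot hk hA) hno
    lia
  let B := S.filter fun U => P ≤ U.1
  let T := S.filter fun U => ¬ P ≤ U.1
  have hBT : B.card + T.card = S.card := Finset.card_filter_add_card_filter_not _
  have hAB : A.card ≤ B.card :=
    Finset.card_le_card fun U hU => Finset.mem_filter.2 ⟨hAS hU, hPA U hU⟩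
  have hBN : B.card ≤ N := (Finset.card_le_card fun U hU =>
    mem_subspacesThrough.2 (Finset.mem_filter.1 hU).2).trans (hN P hP)
  have hT : T.card ≤ 1 := by
    by_contra! hT
    obtain ⟨T₁, hT₁, T₂, hT₂, hne⟩ := Finset.one_lt_card.1 hT
    have := card_through_le_of_two_off hc hX hS hP (Finset.filter_subset _ S)
      (fun U hU => (Finset.mem_filter.1 hU).2) (Finset.mem_filter.1 hT₁).1
      (Finset.mem_filter.1 hT₂).1 hne (Finset.mem_filter.1 hT₁).2 (Finset.mem_filter.1 hT₂).2
    change B.card ≤ _ at this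
    lia
  refine ⟨by lia, ?_⟩
  obtain ⟨v, hv⟩ := Finset.card_eq_one.1 (show T.card = 1 by lia)
  have hvT : v ∈ T := hv ▸ Finset.mem_singleton_self v
  refine ⟨v, (Finset.mem_filter.1 hvT).1, qKneserGraph_isIndepSet_of_point P hP fun U hU => ?_⟩
  by_contra hPU
  have : U ∈ T := Finset.mem_filter.2 ⟨hU.1, hPU⟩
  rw [hv, Finset.mem_singleton] at this
  exact hU.2 this

theorem exists_point_and_subspace_off (hkn : k + 1 ≤ n) (hk : 1 ≤ k) :
    ∃ P : Submodule F (Fin n → F), finrank F P = 1 ∧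
      ∃ U : {U : Submodule F (Fin n → F) // finrank F U = k}, ¬ P ≤ U.1 := by
  have hn : finrank F (Fin n → F) = n := finrank_fin_fun F
  have hpos : 0 < finrank F (Fin n → F) := by lia
  obtain ⟨v, hv⟩ := finrank_pos_iff_exists_ne_zero.1 hpos
  have hP : finrank F (Submodule.span F {v}) = 1 := finrank_span_singleton hv
  obtain ⟨Q, hQ⟩ := Submodule.exists_isCompl (Submodule.span F {v})
  have hdim := Submodule.finrank_add_eq_of_isCompl hQ
  -- A complement of `P` has dimension `n - 1 ≥ k`, so it has room for a `k`-space.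
  obtain ⟨s, hs⟩ := exists_linearIndependent_of_le_finrank (R := F) (M := Q) (n := k) (by lia)
  have hs' := hs.map' Q.subtype Q.ker_subtype
  refine ⟨_, hP, ⟨Submodule.span F (Set.range (Q.subtype ∘ s)), ?_⟩, fun hle => ?_⟩
  · rw [finrank_span_eq_card hs', Fintype.card_fin]
  · have hsub : Submodule.span F (Set.range (Q.subtype ∘ s)) ≤ Q := by
      refine Submodule.span_le.2 ?_
      rintro _ ⟨i, rfl⟩
      exact (s i).2
    have := hQ.disjoint.eq_bot_of_le (hle.trans hsub)
    rw [this, finrank_bot] at hP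
    lia

/-- A full star together with one vertex off it is an induced forest. -/
theorem exists_star_forest [Finite F] {N : ℕ} (hkn : k + 1 ≤ n) (hk : 1 ≤ k)
    (hN : ∀ W : Submodule F (Fin n → F), finrank F W = 1 → (subspacesThrough k W).card = N) :
    ∃ S, (qKneserGraph F n k).IsInducedForest S ∧ S.card = N + 1 := by
  classical
  obtain ⟨P, hP, U, hU⟩ := exists_point_and_subspace_off (F := F) hkn hk
  refine ⟨insert U (subspacesThrough k P), ?_, ?_⟩
  · refine SimpleGraph.isInducedForest_of_isIndepSet_diff (Finset.mem_insert_self _ _)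
      (qKneserGraph_isIndepSet_of_point P hP fun W hW => ?_)
    exact mem_subspacesThrough.1 (Finset.mem_of_mem_insert_of_ne hW.1 hW.2)
  · rw [Finset.card_insert_of_notMem (fun h => hU (mem_subspacesThrough.1 h)), hN P hP]

end Main

/-- The counts of subspaces through a point and through a line satisfy the inequalities that make
a large induced forest a star plus a vertex. -/
theorem star_dominates {q t c X N : ℕ} (hq : 11 ≤ q) (ht : 1 ≤ t) (hX : 1 ≤ X) (hc : c ≤ 2 * t)
    (hN : q * (t * t) * X ≤ N) :
    2 * (c * (c * X)) ≤ N ∧ 2 * (c * X + c * X + 1) ≤ N := by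
  have h : 11 * (t * t * X) ≤ N := by
    calc 11 * (t * t * X) = 11 * (t * t) * X := by ring
      _ ≤ q * (t * t) * X := by gcongr
      _ ≤ N := hN
  have h₁ : c * (c * X) ≤ 4 * (t * t * X) := by
    calc c * (c * X) ≤ 2 * t * (2 * t * X) := by gcongr
      _ = 4 * (t * t * X) := by ring
  have h₂ : c * X ≤ 2 * (t * t * X) := by
    calc c * X ≤ 2 * t * X := by gcongr
      _ = 2 * (1 * t * X) := by ring
      _ ≤ 2 * (t * t * X) := by gcongr
  have h₃ : 1 ≤ t * t * X := Nat.mul_pos (Nat.mul_pos ht ht) hX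
  constructor <;> lia

theorem mainTheorem4 (k n : ℕ) (hk : 2 ≤ k) (hn : 3 * k - 2 < n) :
    ∃ q₀ : ℕ, ∀ (F : Type*) [Field F] [Finite F], q₀ ≤ Nat.card F →
      ((qKneserGraph F n k).maxForestOrder : ℚ) =
          gaussBinom (Nat.card F) (n - 1) (k - 1) + 1 ∧
        ∀ S : Finset {U : Submodule F (Fin n → F) // Module.finrank F U = k},
          (qKneserGraph F n k).IsMaximumInducedForest S →
            (qKneserGraph F n k).IsCanonicalForest S := by
  -- With `t = q^(k-1)`, both quantities to be bounded by `N` are at most `10t²X`, and `N ≥ q t²X`.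
  -- So 11 works for all `n` and `k`.
  refine ⟨11, fun F _ _ hq => ?_⟩
  have hq2 : 2 ≤ Nat.card F := by lia
  have hdim : finrank F (Fin n → F) = n := finrank_fin_fun F
  obtain ⟨X, hX⟩ : ∃ X : ℕ, (X : ℚ) = gaussBinom (Nat.card F) (n - 2) (k - 2) := ⟨_, by
    rw [card_subspaces_eq_gaussBinom (F := F) (V := Fin (n - 2) → F) (k := k - 2)
      (by rw [finrank_fin_fun]; lia), finrank_fin_fun]⟩
  obtain ⟨N, hN⟩ : ∃ N : ℕ, (N : ℚ) = gaussBinom (Nat.card F) (n - 1) (k - 1) := ⟨_, by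
    rw [card_subspaces_eq_gaussBinom (F := F) (V := Fin (n - 1) → F) (k := k - 1)
      (by rw [finrank_fin_fun]; lia), finrank_fin_fun]⟩
  have hXpos : (0 : ℚ) < X := hX ▸ gaussBinom_pos hq2 (by lia)
  have hXcard (W : Submodule F (Fin n → F)) (hW : finrank F W = 2) :
      (subspacesThrough k W).card = X := by
    have := card_subspacesThrough (k := k) W (by lia) (by lia)
    rw [hW, hdim, ← hX] at this
    exact_mod_cast this
  have hNcard (W : Submodule F (Fin n → F)) (hW : finrank F W = 1) :
      (subspacesThrough k W).card = N := by
    have := card_subspacesThrough (k := k) W (by lia) (by lia)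
    rw [hW, hdim, ← hN] at this
    exact_mod_cast this
  have hXN : Nat.card F * (Nat.card F ^ (k - 1) * Nat.card F ^ (k - 1)) * X ≤ N := by
    have h := pow_mul_gaussBinom_le hq2 (show k - 2 ≤ n - 2 by lia) (hX ▸ hXpos.le)
    rw [show n - 2 + 1 = n - 1 by lia, show k - 2 + 1 = k - 1 by lia, ← hX, ← hN] at h
    have h' : Nat.card F ^ (n - 2 - (k - 2)) * X ≤ N := by exact_mod_cast h
    -- The hypothesis `n > 3k - 2` enters here, as `n - k ≥ 2(k - 1) + 1`.
    refine le_trans (Nat.mul_le_mul_right X ?_) h'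
    rw [← pow_add, ← pow_succ']
    exact Nat.pow_le_pow_right (by lia) (by lia)
  obtain ⟨h₁, h₂⟩ := star_dominates hq (Nat.one_le_pow _ _ (by lia)) (by exact_mod_cast hXpos)
    le_rfl hXN
  have key {S : Finset {U : Submodule F (Fin n → F) // finrank F U = k}}
      (hS : (qKneserGraph F n k).IsInducedForest S) (hSN : N + 1 ≤ S.card) :=
    card_eq_and_exists_of_large_forest (by lia) (fun U hU => card_pointsOf_le hU (by lia))
      (fun W hW => (hXcard W hW).le) (fun W hW => (hNcard W hW).le) h₁ h₂ hS hSN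
  obtain ⟨S₀, hS₀, hS₀card⟩ := exists_star_forest (k := k) (by lia) (by lia) hNcard
  constructor
  · have hgreatest : IsGreatest
        {m : ℕ | ∃ S, (qKneserGraph F n k).IsInducedForest S ∧ S.card = m} (N + 1) := by
      refine ⟨⟨S₀, hS₀, hS₀card⟩, ?_⟩
      rintro _ ⟨S, hS, rfl⟩
      by_contra! hlt
      exact hlt.ne' (key hS hlt.le).1
    rw [SimpleGraph.maxForestOrder, hgreatest.csSup_eq, ← hN]
    push_cast
    rfl
  · intro S hS
    exact ⟨hS.1, (key hS.1 (hS₀card ▸ hS.2 S₀ hS₀)).2⟩
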